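/- Let $S$ be a countable set and let $(a(i,j))_{i,j\in S}$ be transition rates with $a(i,j)\ge 0$ and $\sum_{j}a(i,j)<\infty$ for every $i\in S$ (no symmetry is assumed). Let $(X_t)_{t\ge 0}$ be a (jointly measurable, e.g. right-continuous) time-homogeneous continuous-time Markov process on $S$ with transition rates $a(i,j)$ and transition probabilities $p_t(j,k)=\mathbb{P}[X_t=k\mid X_0=j]$, where $\sum_k p_t(j,k)=1$, started in a state $i\in S$. Let $L_t=\int_0^t \mathbf 1_{\{X_s=i\}}\,ds$ be its local time in $i$ and let $G_\infty=\int_0^\infty p_t(i,i)\,dt\in[0,\infty]$. Write $h_1\sim h_2$ if $h_1(t)/h_2(t)\to 1$ as $t\to\infty$. Suppose that $p_t(i,i)\sim c\,t^{-\alpha}$ as $t\to\infty$ for some constants $c>0$ and $\alpha>0$. Then for every $\kappa<0$, as $t\to\infty$, $$\mathbb{E}\big[e^{\kappa L_t}\big]\sim\begin{cases}\dfrac{1}{t^{1-\alpha}}\cdot\dfrac{1}{-\kappa\,c\,\Gamma(1-\alpha)\,\Gamma(\alpha)} & \text{if } 0<\alpha<1,\\[2mm] \dfrac{1}{\log t}\cdot\dfrac{1}{-\kappa\,c}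 & \text{if } \alpha=1,\\[2mm] \dfrac{1}{1-\kappa\,G_\infty} & \text{if } \alpha>1,\end{cases}$$ where $\Gamma$ is the Gamma function, and in the case $\alpha>1$ one has $G_\infty<\infty$. -/

import Mathlib

open Filter Topology MeasureTheory Asymptotics
open scoped NNReal ENNReal

noncomputable section

/-- The `Q`-matrix of the jump rates `a`, i.e. the matrix of the generator
`u ↦ (i ↦ ∑ j, a i j * (u j - u i))`. The value of `a i i` plays no role. -/
def rateMatrix {S : Type*} (a : S → S → ℝ) (i j : S) : ℝ :=
  a i j - Set.indicator {i} (fun _ => ∑' k, a i k) j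

/-- `p t i j` are the transition probabilities of a time-homogeneous continuous-time Markov
process on the countable set `S` with transition rates `a`: a stochastic semigroup whose
derivative at time `0` is the `Q`-matrix of `a`. Only finiteness of the total rate out of each
state is required; no symmetry, homogeneity, boundedness or finite range. -/
structure IsTransitionFunction {S : Type*} (a : S → S → ℝ) (p : ℝ≥0 → S → S → ℝ) : Prop where
  rate_nonneg : ∀ i j, 0 ≤ a i j
  rate_summable : ∀ i, Summable (a i)
  nonneg : ∀ t i j, 0 ≤ p t i j
  hasSum_one : ∀ t i, HasSum (p t i) 1
  zero : ∀ i j, p 0 i j = Set.indicator {i} (fun _ => (1 : ℝ)) j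
  chapman_kolmogorov : ∀ s t i k, HasSum (fun j => p s i j * p t j k) (p (s + t) i k)
  hasDerivWithinAt_zero : ∀ i j,
    HasDerivWithinAt (fun t : ℝ => p t.toNNReal i j) (rateMatrix a i j) (Set.Ici 0) 0

/-- `X` is, under the probability measure `P`, a (jointly measurable) time-homogeneous Markov
process with transition rates `a` and transition probabilities `p`, started in `i`. The Markov
property is expressed by the finite-dimensional distributions:
`P(X_{t_0} = j_0, …, X_{t_n} = j_n) = 1_{j_0 = i} ∏ p_{t_{k+1} - t_k}(j_k, j_{k+1})`
for all `0 = t_0 ≤ t_1 ≤ … ≤ t_n`. -/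
structure IsMarkovProcess {S Ω : Type*} [MeasurableSpace S] [MeasurableSpace Ω]
    (a : S → S → ℝ) (p : ℝ≥0 → S → S → ℝ) (i : S) (P : Measure Ω)
    (X : ℝ≥0 → Ω → S) : Prop where
  isTransitionFunction : IsTransitionFunction a p
  measurable : Measurable (fun z : ℝ≥0 × Ω => X z.1 z.2)
  finiteDim : ∀ (n : ℕ) (t : Fin (n + 1) → ℝ≥0) (j : Fin (n + 1) → S), Monotone t → t 0 = 0 →
    P.real {ω | ∀ k, X (t k) ω = j k} =
      Set.indicator {i} (fun _ => (1 : ℝ)) (j 0) *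
        ∏ k : Fin n, p (t k.succ - t k.castSucc) (j k.castSucc) (j k.succ)

/-- The local time `L_t = ∫_0^t δ_i(X_s) ds` of `X` in the state `i`. -/
def localTime {S Ω : Type*} (X : ℝ≥0 → Ω → S) (i : S) (t : ℝ≥0) (ω : Ω) : ℝ :=
  ∫ s in (0 : ℝ)..(t : ℝ), Set.indicator {i} (fun _ => (1 : ℝ)) (X s.toNNReal ω)

/-- The Green function `G_∞(i, j) = ∫_0^∞ p_t(i, j) dt`, with values in `[0, ∞]`. -/
def greenFunction {S : Type*} (p : ℝ≥0 → S → S → ℝ) (i j : S) : ℝ≥0∞ :=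
  ∫⁻ t in Set.Ioi (0 : ℝ), ENNReal.ofReal (p t.toNNReal i j)

end

/-! Write f(t) = E[e^{κ L_t}] and q(t) = p_t(i,i). Differentiating exp(κ ∫_s^t 1_{X_u = i} du) in s
and applying the Markov property at each visit to i gives the renewal equation f = 1 + κ (q * f),
proved in `expLocalTime_renewal`. Under the Laplace transform the convolution becomes a product, so
f̂(λ) = 1 / (λ (1 - κ q̂(λ))) (`laplaceTransform_expLocalTime`).

The behaviour of q̂(λ) as λ ↓ 0 follows from that of q at infinity by dominated convergence: q̂(λ) ~
c Γ(1-α) λ^{α-1} for α < 1, q̂(λ) ~ c log(1/λ) for α = 1, and q̂(λ) → G_∞ < ∞ for α > 1. Hence the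
asymptotics of f̂ are known.

Since κ < 0, f is nonnegative and nonincreasing, so Karamata's Tauberian theorem
(`tendsto_of_tendsto_mul_laplaceTransform`) turns them into asymptotics of f itself.
`tendsto_expLocalTime_div` packages this so that the three regimes differ only in the normalisation
M and the exponent β. -/

/-- The Laplace transform `λ ↦ ∫_0^∞ e^{-λ t} f(t) dt` of a real function. -/
noncomputable def laplaceTransform (f : ℝ → ℝ) (l : ℝ) : ℝ :=
  ∫ t in Set.Ioi (0 : ℝ), Real.exp (-(l * t)) * f t

/-! ### Exponentially weighted integrals -/

theorem integrableOn_rpow_mul_exp_neg {a r : ℝ} (ha : 0 < a) (hr : 0 < r) :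
    IntegrableOn (fun x : ℝ => x ^ (a - 1) * Real.exp (-(r * x))) (Set.Ioi 0) := by
  -- A non-integrable function has Bochner integral `0`, whereas the Gamma integral is positive.
  by_contra h
  have h1 := Real.integral_rpow_mul_exp_neg_mul_Ioi ha hr
  rw [integral_undef h] at h1
  have := Real.Gamma_pos_of_pos ha
  have : 0 < (1 / r) ^ a * Real.Gamma a := by positivity
  linarith

theorem integrableOn_bounded_comp_exp_neg_mul {u g : ℝ → ℝ} {l : ℝ} (hg : Continuous g)
    (hu : IntegrableOn u (Set.Ioi 0)) (hl : 0 < l) :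
    IntegrableOn (fun t => g (Real.exp (-(l * t))) * u t) (Set.Ioi 0) := by
  obtain ⟨B, hB⟩ := isCompact_Icc.exists_bound_of_continuousOn (s := Set.Icc (0 : ℝ) 1)
    hg.continuousOn
  refine Integrable.bdd_mul (c := B) hu ?_ ?_
  · exact (by fun_prop : Continuous fun t : ℝ => g (Real.exp (-(l * t)))).aestronglyMeasurable
  · refine (ae_restrict_iff' measurableSet_Ioi).2 (ae_of_all _ fun t ht => hB _ ⟨by positivity, ?_⟩)
    rw [Real.exp_le_one_iff, neg_nonpos]
    exact mul_nonneg hl.le (le_of_lt ht)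

theorem abs_setIntegral_comp_exp_neg_mul_sub_le {u g h : ℝ → ℝ} {l ε : ℝ} (hg : Continuous g)
    (hh : Continuous h) (hu : IntegrableOn u (Set.Ioi 0)) (hu0 : ∀ t, 0 < t → 0 ≤ u t) (hl : 0 < l)
    (hgh : ∀ x ∈ Set.Icc (0 : ℝ) 1, |g x - h x| ≤ ε) :
    |(∫ t in Set.Ioi (0 : ℝ), g (Real.exp (-(l * t))) * u t) -
      ∫ t in Set.Ioi (0 : ℝ), h (Real.exp (-(l * t))) * u t| ≤
      ε * ∫ t in Set.Ioi (0 : ℝ), u t := by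
  rw [← integral_sub (integrableOn_bounded_comp_exp_neg_mul hg hu hl)
    (integrableOn_bounded_comp_exp_neg_mul hh hu hl), ← integral_const_mul, ← Real.norm_eq_abs]
  refine norm_integral_le_of_norm_le (hu.const_mul ε) ?_
  refine (ae_restrict_iff' measurableSet_Ioi).2 (ae_of_all _ fun t (ht : 0 < t) => ?_)
  rw [← sub_mul, norm_mul, Real.norm_eq_abs, Real.norm_of_nonneg (hu0 t ht)]
  refine mul_le_mul_of_nonneg_right (hgh _ ⟨by positivity, ?_⟩) (hu0 t ht)
  rw [Real.exp_le_one_iff, neg_nonpos]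
  positivity

/-! ### Karamata's Tauberian theorem -/

section Karamata

variable {f N : ℝ → ℝ} {C α : ℝ}

/-- By linearity only monomials matter. A factor e^{-nlt} turns the transform at l into the one at
(n+1)l, and (n+1)^{-α} Γ(α) is the matching Gamma integral. -/
theorem tendsto_mul_integral_polynomial_exp_neg
    (hfi : ∀ l : ℝ, 0 < l → IntegrableOn (fun t => Real.exp (-(l * t)) * f t) (Set.Ioi 0))
    (hα : 0 < α)
    (h : ∀ n : ℕ, Tendsto (fun l => N l * laplaceTransform f ((n + 1) * l)) (𝓝[>] 0)
      (𝓝 (C * ((n : ℝ) + 1) ^ (-α)))) (q : Polynomial ℝ) :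
    Tendsto (fun l => N l * ∫ t in Set.Ioi (0 : ℝ),
        q.eval (Real.exp (-(l * t))) * (Real.exp (-(l * t)) * f t)) (𝓝[>] 0)
      (𝓝 (C / Real.Gamma α * ∫ x in Set.Ioi (0 : ℝ),
        q.eval (Real.exp (-(1 * x))) * (x ^ (α - 1) * Real.exp (-(1 * x))))) := by
  have hΓ := Real.Gamma_pos_of_pos hα
  induction q using Polynomial.induction_on' with
  | add q r hq hr =>
    have hlim := hq.add hr
    rw [← mul_add, ← integral_add] at hlim
    · refine (hlim.congr' ?_).trans (le_of_eq ?_)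
      · filter_upwards [self_mem_nhdsWithin] with l hl
        rw [← mul_add, ← integral_add]
        · simp only [Polynomial.eval_add, add_mul]
        · exact integrableOn_bounded_comp_exp_neg_mul q.continuous (hfi l hl) hl
        · exact integrableOn_bounded_comp_exp_neg_mul r.continuous (hfi l hl) hl
      · simp only [Polynomial.eval_add, add_mul]
    · exact integrableOn_bounded_comp_exp_neg_mul q.continuous
        (integrableOn_rpow_mul_exp_neg hα one_pos) one_pos
    · exact integrableOn_bounded_comp_exp_neg_mul r.continuous
        (integrableOn_rpow_mul_exp_neg hα one_pos) one_pos
  | monomial n b =>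
    have hn : (0 : ℝ) < (n : ℝ) + 1 := by positivity
    refine (((h n).const_mul b).congr fun l => ?_).trans (le_of_eq ?_)
    · rw [laplaceTransform, ← mul_assoc, mul_comm b, mul_assoc, ← integral_const_mul]
      congr 2 with t
      rw [Polynomial.eval_monomial, ← Real.exp_nat_mul,
        show -(((n : ℝ) + 1) * l * t) = n * -(l * t) + -(l * t) by ring, Real.exp_add]
      ring
    · have : ∀ x : ℝ, (Polynomial.monomial n b).eval (Real.exp (-(1 * x))) *
          (x ^ (α - 1) * Real.exp (-(1 * x))) =
          b * (x ^ (α - 1) * Real.exp (-((n + 1) * x))) := fun x => by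
        rw [Polynomial.eval_monomial, ← Real.exp_nat_mul,
          show -(((n : ℝ) + 1) * x) = n * -(1 * x) + -(1 * x) by ring, Real.exp_add]
        ring
      simp_rw [this]
      rw [integral_const_mul, Real.integral_rpow_mul_exp_neg_mul_Ioi hα hn, one_div,
        Real.inv_rpow hn.le, ← Real.rpow_neg hn.le]
      congr 1
      field_simp

/-- Weierstrass approximation on [0, 1], where e^{-lt} takes its values. The error is uniform
because the total mass N(l) f̂(l) converges, hence stays bounded. -/
theorem tendsto_mul_integral_comp_exp_neg
    (hfi : ∀ l : ℝ, 0 < l → IntegrableOn (fun t => Real.exp (-(l * t)) * f t) (Set.Ioi 0))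
    (hf0 : ∀ t, 0 ≤ f t) (hN : ∀ᶠ l in 𝓝[>] (0 : ℝ), 0 ≤ N l) (hα : 0 < α) (hC : 0 ≤ C)
    (h : ∀ n : ℕ, Tendsto (fun l => N l * laplaceTransform f ((n + 1) * l)) (𝓝[>] 0)
      (𝓝 (C * ((n : ℝ) + 1) ^ (-α)))) {g : ℝ → ℝ} (hg : Continuous g) :
    Tendsto (fun l => N l * ∫ t in Set.Ioi (0 : ℝ),
        g (Real.exp (-(l * t))) * (Real.exp (-(l * t)) * f t)) (𝓝[>] 0)
      (𝓝 (C / Real.Gamma α * ∫ x in Set.Ioi (0 : ℝ),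
        g (Real.exp (-(1 * x))) * (x ^ (α - 1) * Real.exp (-(1 * x))))) := by
  have hΓ := Real.Gamma_pos_of_pos hα
  rw [Metric.tendsto_nhds]
  intro ε hε
  -- C + 1 bounds both C and, eventually, N(l) f̂(l). Each of the two approximation errors and the
  -- polynomial error is then at most ε/4.
  have hη : 0 < ε / (4 * (C + 1)) := by positivity
  obtain ⟨q, hq⟩ := exists_polynomial_near_of_continuousOn 0 1 g hg.continuousOn _ hη
  have hq' : ∀ x ∈ Set.Icc (0 : ℝ) 1, |g x - q.eval x| ≤ ε / (4 * (C + 1)) := fun x hx => by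
    rw [abs_sub_comm]; exact (hq x hx).le
  have hB : ∀ᶠ l in 𝓝[>] (0 : ℝ), N l * laplaceTransform f l < C + 1 := by
    have h0 := h 0
    simp only [Nat.cast_zero, zero_add, one_mul, Real.one_rpow, mul_one] at h0
    exact h0.eventually_lt_const (by linarith)
  have hp := Metric.tendsto_nhds.1 (tendsto_mul_integral_polynomial_exp_neg hfi hα h q) (ε / 4)
    (by positivity)
  have hΓ' : ∫ x in Set.Ioi (0 : ℝ), x ^ (α - 1) * Real.exp (-(1 * x)) = Real.Gamma α := by
    rw [Real.integral_rpow_mul_exp_neg_mul_Ioi hα one_pos]; simp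
  have hT := abs_setIntegral_comp_exp_neg_mul_sub_le hg q.continuous
    (integrableOn_rpow_mul_exp_neg hα one_pos)
    (fun t ht => by positivity) one_pos hq'
  rw [hΓ'] at hT
  filter_upwards [hN, hB, hp, self_mem_nhdsWithin] with l hNl hBl hpl (hl : 0 < l)
  have hTl := abs_setIntegral_comp_exp_neg_mul_sub_le hg q.continuous (hfi l hl)
    (fun t ht => mul_nonneg (Real.exp_pos _).le (hf0 t)) hl hq'
  rw [Real.dist_eq] at hpl ⊢
  set A := ∫ t in Set.Ioi (0 : ℝ), g (Real.exp (-(l * t))) * (Real.exp (-(l * t)) * f t)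
  set A' := ∫ t in Set.Ioi (0 : ℝ), q.eval (Real.exp (-(l * t))) * (Real.exp (-(l * t)) * f t)
  set D := ∫ x in Set.Ioi (0 : ℝ), g (Real.exp (-(1 * x))) * (x ^ (α - 1) * Real.exp (-(1 * x)))
  set D' := ∫ x in Set.Ioi (0 : ℝ),
    q.eval (Real.exp (-(1 * x))) * (x ^ (α - 1) * Real.exp (-(1 * x)))
  have h1 : |N l * A - N l * A'| ≤ ε / 4 := by
    rw [← mul_sub, abs_mul, abs_of_nonneg hNl]
    calc N l * |A - A'| ≤ N l * (ε / (4 * (C + 1)) * laplaceTransform f l) :=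
          mul_le_mul_of_nonneg_left hTl hNl
      _ = ε / (4 * (C + 1)) * (N l * laplaceTransform f l) := by ring
      _ ≤ ε / (4 * (C + 1)) * (C + 1) := by gcongr
      _ = ε / 4 := by field_simp
  have h2 : |C / Real.Gamma α * D - C / Real.Gamma α * D'| ≤ ε / 4 := by
    rw [← mul_sub, abs_mul, abs_of_nonneg (by positivity)]
    calc C / Real.Gamma α * |D - D'|
        ≤ C / Real.Gamma α * (ε / (4 * (C + 1)) * Real.Gamma α) := by gcongr
      _ = ε / (4 * (C + 1)) * C := by field_simp
      _ ≤ ε / (4 * (C + 1)) * (C + 1) := by gcongr; linarith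
      _ = ε / 4 := by field_simp
  rw [abs_lt] at hpl ⊢
  rw [abs_le] at h1 h2
  constructor <;> linarith [h1.1, h1.2, h2.1, h2.2, hpl.1, hpl.2]

/-! ### Localisation to a window by bump functions -/

/-- A continuous bump function whose composition with `x ↦ e^{-x}` is supported in `[u, v]`. -/
noncomputable def expBump (u v y : ℝ) : ℝ :=
  max 0 (y - Real.exp (-v)) * max 0 (Real.exp (-u) - y)

theorem continuous_expBump (u v : ℝ) : Continuous (expBump u v) := by
  unfold expBump; fun_prop

theorem expBump_nonneg (u v y : ℝ) : 0 ≤ expBump u v y :=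
  mul_nonneg (le_max_left _ _) (le_max_left _ _)

theorem mem_Ioo_of_expBump_ne_zero {u v x : ℝ} (h : expBump u v (Real.exp (-x)) ≠ 0) :
    x ∈ Set.Ioo u v := by
  by_contra hx
  apply h
  rw [Set.mem_Ioo, not_and_or, not_lt, not_lt] at hx
  rcases hx with hx | hx
  · rw [expBump, max_eq_left (b := Real.exp (-u) - Real.exp (-x)), mul_zero]
    rw [sub_nonpos, Real.exp_le_exp]; linarith
  · rw [expBump, max_eq_left (b := Real.exp (-x) - Real.exp (-v)), zero_mul]
    rw [sub_nonpos, Real.exp_le_exp]; linarith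

theorem expBump_pos {u v x : ℝ} (hx : x ∈ Set.Ioo u v) : 0 < expBump u v (Real.exp (-x)) := by
  refine mul_pos (lt_max_of_lt_right ?_) (lt_max_of_lt_right ?_) <;>
    rw [sub_pos, Real.exp_lt_exp] <;> linarith [hx.1, hx.2]

theorem integrableOn_exp_neg_mul {l : ℝ} (hl : 0 < l) :
    IntegrableOn (fun x : ℝ => Real.exp (-(l * x))) (Set.Ioi 0) := by
  simpa using integrableOn_rpow_mul_exp_neg one_pos hl

theorem setIntegral_expBump_pos {u v : ℝ} (hu : 0 ≤ u) (huv : u < v) :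
    0 < ∫ x in Set.Ioi (0 : ℝ), expBump u v (Real.exp (-(1 * x))) * Real.exp (-(1 * x)) := by
  rw [setIntegral_pos_iff_support_of_nonneg_ae]
  · refine lt_of_lt_of_le (b := volume (Set.Ioo u v)) (by simpa using huv) (measure_mono ?_)
    intro x hx
    refine ⟨?_, lt_of_le_of_lt hu hx.1⟩
    simpa using (expBump_pos hx).ne'
  · exact ae_of_all _ fun x => mul_nonneg (expBump_nonneg _ _ _) (Real.exp_pos _).le
  · exact integrableOn_bounded_comp_exp_neg_mul (continuous_expBump u v)
      (integrableOn_exp_neg_mul one_pos) one_pos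

theorem setIntegral_expBump_rescale {l : ℝ} (hl : 0 < l) (u v : ℝ) :
    ∫ t in Set.Ioi (0 : ℝ), expBump u v (Real.exp (-(l * t))) * Real.exp (-(l * t)) =
      l⁻¹ * ∫ x in Set.Ioi (0 : ℝ), expBump u v (Real.exp (-(1 * x))) * Real.exp (-(1 * x)) := by
  have := integral_comp_mul_left_Ioi
    (fun x => expBump u v (Real.exp (-(1 * x))) * Real.exp (-(1 * x))) 0 hl
  simpa using this

/-- A bound on w is needed only for lt in (u, v), where the bump lives. The factor l⁻¹ comes from
rescaling the mass of the bump to l = 1. -/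
theorem setIntegral_expBump_mul_le {l u v K : ℝ} {w : ℝ → ℝ} (hl : 0 < l)
    (hw : IntegrableOn (fun t => Real.exp (-(l * t)) * w t) (Set.Ioi 0))
    (h : ∀ t, 0 < t → u < l * t → l * t < v → w t ≤ K) :
    ∫ t in Set.Ioi (0 : ℝ), expBump u v (Real.exp (-(l * t))) * (Real.exp (-(l * t)) * w t) ≤
      K * (l⁻¹ * ∫ x in Set.Ioi (0 : ℝ),
        expBump u v (Real.exp (-(1 * x))) * Real.exp (-(1 * x))) := by
  rw [← setIntegral_expBump_rescale hl, ← integral_const_mul]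
  refine setIntegral_mono_on ?_ ?_ measurableSet_Ioi fun t ht => ?_
  · exact integrableOn_bounded_comp_exp_neg_mul (continuous_expBump u v) hw hl
  · exact (integrableOn_bounded_comp_exp_neg_mul (continuous_expBump u v)
      (integrableOn_exp_neg_mul hl) hl).const_mul K
  · by_cases h0 : expBump u v (Real.exp (-(l * t))) = 0
    · simp [h0]
    · obtain ⟨h1, h2⟩ := mem_Ioo_of_expBump_ne_zero h0
      rw [← mul_assoc, mul_comm K]
      exact mul_le_mul_of_nonneg_left (h t ht h1 h2)
        (mul_nonneg (expBump_nonneg _ _ _) (Real.exp_pos _).le)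

theorem le_setIntegral_expBump_mul {l u v K : ℝ} {w : ℝ → ℝ} (hl : 0 < l)
    (hw : IntegrableOn (fun t => Real.exp (-(l * t)) * w t) (Set.Ioi 0))
    (h : ∀ t, 0 < t → u < l * t → l * t < v → K ≤ w t) :
    K * (l⁻¹ * ∫ x in Set.Ioi (0 : ℝ),
        expBump u v (Real.exp (-(1 * x))) * Real.exp (-(1 * x))) ≤
      ∫ t in Set.Ioi (0 : ℝ), expBump u v (Real.exp (-(l * t))) * (Real.exp (-(l * t)) * w t) := by
  have := setIntegral_expBump_mul_le (u := u) (v := v) (K := -K) (w := fun t => -w t) hl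
    (by simpa using hw.neg) fun t h0 h1 h2 => neg_le_neg (h t h0 h1 h2)
  simp only [mul_neg, integral_neg, neg_mul] at this
  exact neg_le_neg_iff.1 this

/-- Karamata's Tauberian theorem for a monotone density: if `N(λ) · f̂(n λ) → C n^{-α}` as `λ ↓ 0`
for every `n ≥ 1`, where `f ≥ 0` is nonincreasing, then `λ⁻¹ N(λ) f(λ⁻¹) → C / Γ(α)`. -/
theorem tendsto_of_tendsto_mul_laplaceTransform
    (hfi : ∀ l : ℝ, 0 < l → IntegrableOn (fun t => Real.exp (-(l * t)) * f t) (Set.Ioi 0))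
    (hf0 : ∀ t, 0 ≤ f t) (hf : Antitone f) (hN : ∀ᶠ l in 𝓝[>] (0 : ℝ), 0 ≤ N l)
    (hα : 0 < α) (hα1 : α ≤ 1) (hC : 0 ≤ C)
    (h : ∀ n : ℕ, Tendsto (fun l => N l * laplaceTransform f ((n + 1) * l)) (𝓝[>] 0)
      (𝓝 (C * ((n : ℝ) + 1) ^ (-α)))) :
    Tendsto (fun l => N l * l⁻¹ * f l⁻¹) (𝓝[>] 0) (𝓝 (C / Real.Gamma α)) := by
  have hΓ := Real.Gamma_pos_of_pos hα
  have hK : 0 ≤ C / Real.Gamma α := by positivity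
  have hcont : Tendsto (fun δ : ℝ => C / Real.Gamma α * δ ^ (α - 1)) (𝓝 1)
      (𝓝 (C / Real.Gamma α)) := by
    have := ((Real.continuousAt_rpow_const 1 (α - 1) (Or.inl one_ne_zero)).tendsto).const_mul
      (C / Real.Gamma α)
    simpa using this
  have hwi : IntegrableOn (fun x : ℝ => Real.exp (-(1 * x)) * x ^ (α - 1)) (Set.Ioi 0) :=
    (integrableOn_rpow_mul_exp_neg hα one_pos).congr_fun (fun x _ => mul_comm _ _)
      measurableSet_Ioi
  rw [tendsto_order]
  constructor
  · intro b hb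
    -- Lower bound: on the window 1 < lt < δ monotonicity gives f(t) ≤ f(l⁻¹), while α ≤ 1 makes the
    -- limiting density x^{α-1} at least δ^{α-1}. As δ → 1 nothing is lost.
    obtain ⟨δ, hδ, hδ1⟩ : ∃ δ : ℝ, b < C / Real.Gamma α * δ ^ (α - 1) ∧ 1 < δ :=
      (((hcont.mono_left nhdsWithin_le_nhds).eventually_const_lt hb).and
        (eventually_mem_nhdsWithin (s := Set.Ioi (1 : ℝ)))).exists
    set I := ∫ x in Set.Ioi (0 : ℝ), expBump 1 δ (Real.exp (-(1 * x))) * Real.exp (-(1 * x)) with hI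
    have hIpos : 0 < I := setIntegral_expBump_pos zero_le_one hδ1
    have hT := tendsto_mul_integral_comp_exp_neg hfi hf0 hN hα hC h (continuous_expBump 1 δ)
    have hlow : δ ^ (α - 1) * (1⁻¹ * I) ≤ _ := le_setIntegral_expBump_mul (u := 1) (v := δ)
      (K := δ ^ (α - 1)) one_pos hwi fun t h0 _ h2 =>
        Real.rpow_le_rpow_of_nonpos h0 (by linarith) (by linarith)
    rw [inv_one, one_mul] at hlow
    simp only [mul_comm (Real.exp (-(1 * _))) (_ ^ (α - 1))] at hlow
    have hb' := hT.eventually_const_lt (u := b * I) (by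
      calc b * I < C / Real.Gamma α * δ ^ (α - 1) * I := by gcongr
        _ = C / Real.Gamma α * (δ ^ (α - 1) * I) := by ring
        _ ≤ _ := mul_le_mul_of_nonneg_left hlow hK)
    filter_upwards [hb', hN, self_mem_nhdsWithin] with l hbl hNl (hl : 0 < l)
    have hup := setIntegral_expBump_mul_le (u := 1) (v := δ) (K := f l⁻¹) hl (hfi l hl)
      fun t h0 h1 _ => hf (by rw [inv_le_iff_one_le_mul₀ hl, mul_comm]; exact h1.le)
    have := hbl.trans_le (mul_le_mul_of_nonneg_left hup hNl)
    rw [← hI] at this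
    refine lt_of_mul_lt_mul_right (this.trans_eq ?_) hIpos.le
    ring
  · intro b hb
    -- Upper bound: the mirror image, with the window δ < lt < 1 to the left of 1 and both
    -- inequalities reversed.
    obtain ⟨δ, hδ, hδ1, hδ0⟩ : ∃ δ : ℝ, C / Real.Gamma α * δ ^ (α - 1) < b ∧ δ < 1 ∧ 0 < δ :=
      (((hcont.mono_left nhdsWithin_le_nhds).eventually_lt_const hb).and
        ((eventually_mem_nhdsWithin (s := Set.Iio (1 : ℝ))).and
          (mem_nhdsWithin_of_mem_nhds (Ioi_mem_nhds one_pos)))).exists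
    set I := ∫ x in Set.Ioi (0 : ℝ), expBump δ 1 (Real.exp (-(1 * x))) * Real.exp (-(1 * x)) with hI
    have hIpos : 0 < I := setIntegral_expBump_pos hδ0.le hδ1
    have hT := tendsto_mul_integral_comp_exp_neg hfi hf0 hN hα hC h (continuous_expBump δ 1)
    have hup : _ ≤ δ ^ (α - 1) * (1⁻¹ * I) := setIntegral_expBump_mul_le (u := δ) (v := 1)
      (K := δ ^ (α - 1)) one_pos hwi fun t h0 h1 _ =>
        Real.rpow_le_rpow_of_nonpos hδ0 (by linarith) (by linarith)
    rw [inv_one, one_mul] at hup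
    simp only [mul_comm (Real.exp (-(1 * _))) (_ ^ (α - 1))] at hup
    have hb' := hT.eventually_lt_const (u := b * I) (by
      calc _ ≤ C / Real.Gamma α * (δ ^ (α - 1) * I) := mul_le_mul_of_nonneg_left hup hK
        _ = C / Real.Gamma α * δ ^ (α - 1) * I := by ring
        _ < b * I := by gcongr)
    filter_upwards [hb', hN, self_mem_nhdsWithin] with l hbl hNl (hl : 0 < l)
    have hlow := le_setIntegral_expBump_mul (u := δ) (v := 1) (K := f l⁻¹) hl (hfi l hl)
      fun t h0 _ h2 => hf (by rw [← one_div, le_div_iff₀ hl, mul_comm]; exact h2.le)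
    have := (mul_le_mul_of_nonneg_left hlow hNl).trans_lt hbl
    rw [← hI] at this
    refine lt_of_mul_lt_mul_right (Eq.trans_lt ?_ this) hIpos.le
    ring

end Karamata

/-! ### Abelian asymptotics of the transform of the return probability -/

section Abelian

variable {q : ℝ → ℝ} {c α : ℝ}

theorem exists_le_mul_rpow_neg (hq1 : ∀ t, q t ≤ 1) (hα : 0 < α)
    (h : Tendsto (fun t => t ^ α * q t) atTop (𝓝 c)) :
    ∃ B, 0 ≤ B ∧ ∀ t, 0 < t → t ^ α * q t ≤ B := by
  obtain ⟨T, hT⟩ := eventually_atTop.1 (h.eventually_le_const (lt_add_one c))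
  refine ⟨max (|T| ^ α) (c + 1), le_max_of_le_left (by positivity), fun t ht => ?_⟩
  rcases le_total T t with h1 | h1
  · exact le_max_of_le_right (hT t h1)
  · refine le_max_of_le_left ?_
    calc t ^ α * q t ≤ t ^ α * 1 := mul_le_mul_of_nonneg_left (hq1 t) (by positivity)
      _ ≤ |T| ^ α := by
        rw [mul_one]
        exact Real.rpow_le_rpow ht.le (h1.trans (le_abs_self T)) hα.le

/-- Substitute t = x/l. The factor (x/l)^α q(x/l) is bounded and tends to c, and x^{-α} e^{-x} is
integrable because α < 1. -/
theorem tendsto_rpow_mul_laplaceTransform (hqm : Measurable q) (hq0 : ∀ t, 0 ≤ q t)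
    (hq1 : ∀ t, q t ≤ 1) (hα : 0 < α) (hα1 : α < 1)
    (h : Tendsto (fun t => t ^ α * q t) atTop (𝓝 c)) :
    Tendsto (fun l => l ^ (1 - α) * laplaceTransform q l) (𝓝[>] 0)
      (𝓝 (c * Real.Gamma (1 - α))) := by
  obtain ⟨B, hB0, hB⟩ := exists_le_mul_rpow_neg hq1 hα h
  have hint := integrableOn_rpow_mul_exp_neg (a := 1 - α) (r := 1) (by linarith) one_pos
  have hval := Real.integral_rpow_mul_exp_neg_mul_Ioi (a := 1 - α) (r := 1) (by linarith) one_pos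
  simp only [div_one, Real.one_rpow, one_mul, sub_sub_cancel_left] at hint hval
  rw [← hval, ← integral_const_mul]
  have hscale : ∀ l ∈ Set.Ioi (0 : ℝ), l ^ (1 - α) * laplaceTransform q l =
      ∫ x in Set.Ioi (0 : ℝ), ((l⁻¹ * x) ^ α * q (l⁻¹ * x)) * (x ^ (-α) * Real.exp (-x)) := by
    intro l (hl : 0 < l)
    have h1 := integral_comp_mul_left_Ioi (fun x => Real.exp (-x) * q (l⁻¹ * x)) 0 hl
    simp only [inv_mul_cancel_left₀ hl.ne', mul_zero, smul_eq_mul] at h1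
    rw [laplaceTransform, h1, ← mul_assoc, ← integral_const_mul]
    refine setIntegral_congr_fun measurableSet_Ioi fun x (hx : 0 < x) => ?_
    rw [Real.mul_rpow (by positivity) hx.le, Real.inv_rpow hl.le, ← Real.rpow_neg hl.le,
      Real.rpow_sub hl, Real.rpow_one, Real.rpow_neg hl.le, Real.rpow_neg hx.le]
    have := (Real.rpow_pos_of_pos hx α).ne'
    field_simp
  refine (tendsto_congr' (eventually_nhdsWithin_of_forall hscale)).2 ?_
  refine tendsto_integral_filter_of_dominated_convergence
    (fun x => B * (x ^ (-α) * Real.exp (-x))) ?_ ?_ (hint.const_mul B) ?_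
  · refine Eventually.of_forall fun l => Measurable.aestronglyMeasurable ?_
    have : Measurable fun x => q (l⁻¹ * x) := hqm.comp (by fun_prop)
    fun_prop
  · filter_upwards [self_mem_nhdsWithin] with l (hl : 0 < l)
    refine (ae_restrict_iff' measurableSet_Ioi).2 (ae_of_all _ fun x (hx : 0 < x) => ?_)
    have h0 := hq0 (l⁻¹ * x)
    rw [Real.norm_of_nonneg (by positivity)]
    exact mul_le_mul_of_nonneg_right (hB _ (by positivity)) (by positivity)
  · refine (ae_restrict_iff' measurableSet_Ioi).2 (ae_of_all _ fun x (hx : 0 < x) => ?_)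
    exact (h.comp (tendsto_inv_nhdsGT_zero.atTop_mul_const hx)).mul_const _

theorem integrableOn_exp_neg_mul_of_bounded (hqm : Measurable q) (hq0 : ∀ t, 0 ≤ q t)
    (hq1 : ∀ t, q t ≤ 1) {l : ℝ} (hl : 0 < l) :
    IntegrableOn (fun t => Real.exp (-(l * t)) * q t) (Set.Ioi 0) :=
  (integrableOn_exp_neg_mul hl).mul_bdd (c := 1) hqm.aestronglyMeasurable
    (ae_of_all _ fun t => by rw [Real.norm_of_nonneg (hq0 t)]; exact hq1 t)

/-- On the logarithmic scale t = e^{Lu} with L = log(1/l), the cutoff e^{-lt} is exp(-e^{L(u-1)}),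
which converges to the indicator of u < 1. The limit is therefore c times the length of (0, 1). -/
theorem tendsto_integral_exp_neg_exp_mul (hqm : Measurable q) (hq0 : ∀ t, 0 ≤ q t)
    (hq1 : ∀ t, q t ≤ 1) (h : Tendsto (fun t => t * q t) atTop (𝓝 c)) :
    Tendsto (fun L : ℝ => ∫ u in Set.Ioi (0 : ℝ), Real.exp (-Real.exp (L * (u - 1))) *
      (Real.exp (L * u) * q (Real.exp (L * u)))) atTop (𝓝 c) := by
  obtain ⟨B, hB0, hB⟩ := exists_le_mul_rpow_neg (α := 1) (c := c) hq1 one_pos (by simpa using h)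
  simp only [Real.rpow_one] at hB
  have hval : ∫ u in Set.Ioi (0 : ℝ), Set.indicator (Set.Iio 1) (fun _ => c) u = c := by
    rw [setIntegral_indicator measurableSet_Iio, Set.Ioi_inter_Iio]
    simp
  rw [← hval]
  refine tendsto_integral_filter_of_dominated_convergence
    (fun u => (B * Real.exp 1) * Real.exp (-(1 * u))) ?_ ?_
    ((integrableOn_exp_neg_mul one_pos).const_mul _) ?_
  · refine Eventually.of_forall fun L => Measurable.aestronglyMeasurable ?_
    have : Measurable fun u => q (Real.exp (L * u)) := hqm.comp (by fun_prop)
    fun_prop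
  · filter_upwards [eventually_ge_atTop 1] with L hL
    refine ae_of_all _ fun u => ?_
    have h0 := hq0 (Real.exp (L * u))
    -- For u ≤ 1 the right side is at least 1. For u ≥ 1 and L ≥ 1, e^{L(u-1)} ≥ 1 + L(u-1) ≥ u.
    have h1 : Real.exp (-Real.exp (L * (u - 1))) ≤ Real.exp 1 * Real.exp (-(1 * u)) := by
      rw [← Real.exp_add, Real.exp_le_exp]
      rcases le_total u 1 with hu | hu
      · linarith [Real.exp_pos (L * (u - 1))]
      · nlinarith [Real.add_one_le_exp (L * (u - 1))]
    rw [Real.norm_of_nonneg (by positivity), mul_assoc, mul_comm B]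
    exact mul_le_mul h1 (hB _ (Real.exp_pos _)) (by positivity) (by positivity)
  · have hne : ∀ᵐ u : ℝ ∂volume.restrict (Set.Ioi 0), u ≠ 1 :=
      ae_restrict_of_ae (by simp [ae_iff, measure_singleton])
    filter_upwards [hne, ae_restrict_mem measurableSet_Ioi] with u hu (hu0 : 0 < u)
    have h2 : Tendsto (fun L : ℝ => Real.exp (L * u) * q (Real.exp (L * u))) atTop (𝓝 c) :=
      h.comp (Real.tendsto_exp_atTop.comp (tendsto_id.atTop_mul_const hu0))
    rcases lt_or_gt_of_ne hu with hlt | hgt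
    · rw [Set.indicator_of_mem (Set.mem_Iio.2 hlt)]
      have h3 : Tendsto (fun L : ℝ => Real.exp (-Real.exp (L * (u - 1)))) atTop (𝓝 1) := by
        have := ((Real.tendsto_exp_atBot.comp
          (tendsto_id.atTop_mul_const_of_neg (sub_neg.2 hlt))).neg).rexp
        simpa using this
      simpa using h3.mul h2
    · rw [Set.indicator_of_notMem (by simpa using hgt.le)]
      have h3 : Tendsto (fun L : ℝ => Real.exp (-Real.exp (L * (u - 1)))) atTop (𝓝 0) :=
        Real.tendsto_exp_neg_atTop_nhds_zero.comp
          (Real.tendsto_exp_atTop.comp (tendsto_id.atTop_mul_const (sub_pos.2 hgt)))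
      simpa using h3.mul h2

theorem setIntegral_Ioi_one_eq_log_mul {l : ℝ} (hl : 0 < l) (hl1 : l < 1) (q : ℝ → ℝ) :
    ∫ t in Set.Ioi (1 : ℝ), Real.exp (-(l * t)) * q t =
      Real.log l⁻¹ * ∫ u in Set.Ioi (0 : ℝ), Real.exp (-Real.exp (Real.log l⁻¹ * (u - 1))) *
        (Real.exp (Real.log l⁻¹ * u) * q (Real.exp (Real.log l⁻¹ * u))) := by
  set L := Real.log l⁻¹ with hL
  have hLpos : 0 < L := Real.log_pos ((one_lt_inv₀ hl).2 hl1)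
  have himage : (fun u => Real.exp (L * u)) '' Set.Ioi 0 = Set.Ioi 1 := by
    ext t
    constructor
    · rintro ⟨u, hu, rfl⟩
      exact Real.one_lt_exp_iff.2 (mul_pos hLpos hu)
    · intro (ht : 1 < t)
      refine ⟨L⁻¹ * Real.log t, mul_pos (inv_pos.2 hLpos) (Real.log_pos ht), ?_⟩
      simp only [mul_inv_cancel_left₀ hLpos.ne']
      exact Real.exp_log (by linarith)
  rw [← himage, integral_image_eq_integral_abs_deriv_smul
    (f' := fun u => Real.exp (L * u) * L) measurableSet_Ioi, ← integral_const_mul]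
  · refine setIntegral_congr_fun measurableSet_Ioi fun u _ => ?_
    have hl' : l * Real.exp (L * u) = Real.exp (L * (u - 1)) := by
      rw [mul_sub, mul_one, Real.exp_sub, hL, Real.exp_log (inv_pos.2 hl), div_inv_eq_mul, mul_comm]
    simp only [smul_eq_mul]
    rw [abs_of_pos (mul_pos (Real.exp_pos _) hLpos), hl']
    ring
  · intro u _
    have := (((hasDerivAt_id u).const_mul L).exp).hasDerivWithinAt (s := Set.Ioi 0)
    simpa using this
  · intro u _ v _ huv
    exact mul_left_cancel₀ hLpos.ne' (Real.exp_injective huv)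

theorem tendsto_log_inv_nhdsGT_zero : Tendsto (fun l : ℝ => Real.log l⁻¹) (𝓝[>] 0) atTop :=
  Real.tendsto_log_atTop.comp tendsto_inv_nhdsGT_zero

/-- The integral over (0, 1] is at most 1 and disappears after division by log(1/l). The rest is
handled on the logarithmic scale. -/
theorem tendsto_inv_log_mul_laplaceTransform (hqm : Measurable q) (hq0 : ∀ t, 0 ≤ q t)
    (hq1 : ∀ t, q t ≤ 1) (h : Tendsto (fun t => t * q t) atTop (𝓝 c)) :
    Tendsto (fun l => (Real.log l⁻¹)⁻¹ * laplaceTransform q l) (𝓝[>] 0) (𝓝 c) := by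
  have hmain := (tendsto_integral_exp_neg_exp_mul hqm hq0 hq1 h).comp tendsto_log_inv_nhdsGT_zero
  have hsmall : Tendsto (fun l => (Real.log l⁻¹)⁻¹ *
      ∫ t in Set.Ioc (0 : ℝ) 1, Real.exp (-(l * t)) * q t) (𝓝[>] 0) (𝓝 0) := by
    refine (tendsto_inv_atTop_zero.comp tendsto_log_inv_nhdsGT_zero).zero_mul_isBoundedUnder_le ?_
    refine ⟨1, ?_⟩
    rw [eventually_map]
    filter_upwards [self_mem_nhdsWithin] with l (hl : 0 < l)
    have := norm_setIntegral_le_of_norm_le_const (μ := volume) (s := Set.Ioc (0 : ℝ) 1) (C := 1)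
      (f := fun t => Real.exp (-(l * t)) * q t) (by simp) fun t ht => ?_
    · simpa using this
    · rw [norm_mul, Real.norm_of_nonneg (Real.exp_pos _).le, Real.norm_of_nonneg (hq0 t)]
      exact mul_le_one₀ (Real.exp_le_one_iff.2 (neg_nonpos.2 (mul_nonneg hl.le ht.1.le))) (hq0 t)
        (hq1 t)
  have hsum := hsmall.add hmain
  rw [zero_add] at hsum
  refine hsum.congr' ?_
  filter_upwards [Ioo_mem_nhdsGT (zero_lt_one' ℝ)] with l hl
  have hLpos : 0 < Real.log l⁻¹ := Real.log_pos ((one_lt_inv₀ hl.1).2 hl.2)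
  have hi := integrableOn_exp_neg_mul_of_bounded hqm hq0 hq1 hl.1
  have hsplit : laplaceTransform q l = ∫ t in Set.Ioc (0 : ℝ) 1 ∪ Set.Ioi 1,
      Real.exp (-(l * t)) * q t := by
    rw [Set.Ioc_union_Ioi_eq_Ioi (zero_le_one' ℝ), laplaceTransform]
  rw [hsplit, setIntegral_union (Set.Ioc_disjoint_Ioi le_rfl) measurableSet_Ioi
      (hi.mono_set Set.Ioc_subset_Ioi_self) (hi.mono_set (Set.Ioi_subset_Ioi zero_le_one)),
    setIntegral_Ioi_one_eq_log_mul hl.1 hl.2, mul_add, inv_mul_cancel_left₀ hLpos.ne']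
  rfl

theorem integrableOn_Ioi_of_tendsto_rpow_mul (hqm : Measurable q) (hq0 : ∀ t, 0 ≤ q t)
    (hq1 : ∀ t, q t ≤ 1) (hα : 1 < α) (h : Tendsto (fun t => t ^ α * q t) atTop (𝓝 c)) :
    IntegrableOn q (Set.Ioi 0) := by
  obtain ⟨B, hB0, hB⟩ := exists_le_mul_rpow_neg hq1 (by linarith) h
  rw [← Set.Ioc_union_Ioi_eq_Ioi (zero_le_one' ℝ)]
  refine IntegrableOn.union ?_ ?_
  · exact Integrable.of_bound hqm.aestronglyMeasurable 1
      (ae_of_all _ fun t => by rw [Real.norm_of_nonneg (hq0 t)]; exact hq1 t)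
  · refine Integrable.mono' ((integrableOn_Ioi_rpow_of_lt (neg_lt_neg hα) one_pos).const_mul B)
      hqm.aestronglyMeasurable ?_
    filter_upwards [ae_restrict_mem measurableSet_Ioi] with t (ht : 1 < t)
    have ht0 : 0 < t := by linarith
    rw [Real.norm_of_nonneg (hq0 t), Real.rpow_neg ht0.le, ← div_eq_mul_inv,
      le_div_iff₀ (Real.rpow_pos_of_pos ht0 α), mul_comm]
    exact hB t ht0

theorem tendsto_laplaceTransform_of_integrableOn (hqi : IntegrableOn q (Set.Ioi 0)) :
    Tendsto (laplaceTransform q) (𝓝[>] 0) (𝓝 (∫ t in Set.Ioi (0 : ℝ), q t)) := by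
  refine tendsto_integral_filter_of_dominated_convergence (fun t => ‖q t‖) ?_ ?_ hqi.norm ?_
  · exact Eventually.of_forall fun l =>
      (by fun_prop : Continuous fun t : ℝ => Real.exp (-(l * t))).aestronglyMeasurable.mul
        hqi.aestronglyMeasurable
  · filter_upwards [self_mem_nhdsWithin] with l (hl : 0 < l)
    filter_upwards [ae_restrict_mem measurableSet_Ioi] with t (ht : 0 < t)
    rw [norm_mul, Real.norm_of_nonneg (Real.exp_pos _).le]
    exact mul_le_of_le_one_left (norm_nonneg _) (Real.exp_le_one_iff.2 (neg_nonpos.2 (by positivity)))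
  · refine ae_of_all _ fun t => ?_
    have : Tendsto (fun l : ℝ => Real.exp (-(l * t)) * q t) (𝓝 0) (𝓝 (Real.exp (-(0 * t)) * q t)) :=
      (by fun_prop : Continuous fun l : ℝ => Real.exp (-(l * t)) * q t).tendsto 0
    simpa using this.mono_left nhdsWithin_le_nhds

end Abelian

/-! ### Pathwise identity for the exponential functional -/

/-- Fundamental theorem of calculus for s ↦ exp(κ ∫_s^t g). The integral runs over the future [s,
t], not the past, so that the Markov property at time s applies. As g is merely measurable, the
function is differentiable only almost everywhere, and absolute continuity is needed. -/
theorem exp_mul_integral_sub_one {g : ℝ → ℝ} (hg : Measurable g) (hg0 : ∀ s, 0 ≤ g s)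
    (hg1 : ∀ s, g s ≤ 1) {κ : ℝ} (hκ : κ ≤ 0) {t : ℝ} (ht : 0 ≤ t) :
    Real.exp (κ * ∫ u in (0 : ℝ)..t, g u) =
      1 + κ * ∫ s in (0 : ℝ)..t, g s * Real.exp (κ * ∫ u in s..t, g u) := by
  have hgb : ∀ s, ‖g s‖ ≤ 1 := fun s => by rw [Real.norm_of_nonneg (hg0 s)]; exact hg1 s
  have hgi : ∀ a b, IntervalIntegrable g volume a b := fun a b =>
    (intervalIntegrable_const (c := (1 : ℝ))).mono_fun hg.aestronglyMeasurable
      (ae_of_all _ fun s => by simpa using hgb s)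
  have hloc : LocallyIntegrable g volume := by
    refine (locallyIntegrable_const (1 : ℝ)).mono hg.aestronglyMeasurable
      (ae_of_all _ fun s => ?_)
    rw [norm_one]
    exact hgb s
  set F : ℝ → ℝ := fun s => Real.exp (κ * ∫ u in s..t, g u) with hF
  -- The exponent is nonpositive because κ ≤ 0 ≤ g, and there exp is 1-Lipschitz.
  have hexp : LipschitzOnWith 1 Real.exp (Set.Iic 0) := by
    refine (convex_Iic 0).lipschitzOnWith_of_nnnorm_deriv_le
      (fun x _ => Real.differentiableAt_exp) fun x hx => ?_
    rw [Real.deriv_exp, ← NNReal.coe_le_coe, coe_nnnorm, Real.norm_of_nonneg (Real.exp_pos x).le]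
    exact Real.exp_le_one_iff.2 hx
  have hlin : LipschitzOnWith (Real.toNNReal |κ|) (fun s => κ * ∫ u in s..t, g u) (Set.uIcc 0 t) := by
    refine LipschitzOnWith.of_dist_le_mul fun x _ y _ => ?_
    rw [Real.dist_eq, ← mul_sub, sub_eq_of_eq_add
      (intervalIntegral.integral_add_adjacent_intervals (hgi x y) (hgi y t)).symm,
      abs_mul, Real.coe_toNNReal _ (abs_nonneg κ), Real.dist_eq, abs_sub_comm x y]
    refine mul_le_mul_of_nonneg_left ?_ (abs_nonneg κ)
    simpa using intervalIntegral.norm_integral_le_of_norm_le_const (a := x) (b := y)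
      fun u _ => hgb u
  have hAC : AbsolutelyContinuousOnInterval F 0 t := by
    refine LipschitzOnWith.absolutelyContinuousOnInterval (K := 1 * Real.toNNReal |κ|) ?_
    refine hexp.comp hlin fun s hs => ?_
    rw [Set.uIcc_of_le ht] at hs
    exact mul_nonpos_of_nonpos_of_nonneg hκ
      (intervalIntegral.integral_nonneg hs.2 fun u _ => hg0 u)
  have hd : ∀ᵐ s, deriv F s = -(κ * (g s * F s)) := by
    filter_upwards [_root_.LocallyIntegrable.ae_hasDerivAt_integral hloc] with s hs
    have h1 : HasDerivAt (fun x => ∫ u in x..t, g u) (-g s) s := by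
      have := (hs t).neg
      refine this.congr_of_eventuallyEq (Eventually.of_forall fun x => ?_)
      exact intervalIntegral.integral_symm _ _
    rw [((h1.const_mul κ).exp).deriv]
    ring
  have hftc := hAC.integral_deriv_eq_sub
  rw [intervalIntegral.integral_congr_ae (hd.mono fun s hs _ => hs), intervalIntegral.integral_neg,
    intervalIntegral.integral_const_mul] at hftc
  simp only [hF, intervalIntegral.integral_same, mul_zero, Real.exp_zero] at hftc
  linarith

/-! ### Markov property for functionals of the occupation time -/

section Visits

variable {S Ω : Type*}

/-- The indicator of the event that `X` is in `i` at time `s`. -/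
noncomputable def visit (X : ℝ≥0 → Ω → S) (i : S) (s : ℝ≥0) (ω : Ω) : ℝ :=
  Set.indicator {i} (fun _ => (1 : ℝ)) (X s ω)

/-- The time spent in `i` during `[s, s + r]`. -/
noncomputable def occupation (X : ℝ≥0 → Ω → S) (i : S) (s : ℝ≥0) (r : ℝ) (ω : Ω) : ℝ :=
  ∫ u in (0 : ℝ)..r, visit X i (s + u.toNNReal) ω

theorem visit_nonneg (X : ℝ≥0 → Ω → S) (i : S) (s : ℝ≥0) (ω : Ω) : 0 ≤ visit X i s ω :=
  Set.indicator_nonneg (fun _ _ => zero_le_one) _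

theorem visit_le_one (X : ℝ≥0 → Ω → S) (i : S) (s : ℝ≥0) (ω : Ω) : visit X i s ω ≤ 1 :=
  Set.indicator_le_self' (fun _ _ => zero_le_one) _

theorem norm_visit_le_one (X : ℝ≥0 → Ω → S) (i : S) (s : ℝ≥0) (ω : Ω) : ‖visit X i s ω‖ ≤ 1 := by
  rw [Real.norm_of_nonneg (visit_nonneg X i s ω)]; exact visit_le_one X i s ω

theorem occupation_nonneg (X : ℝ≥0 → Ω → S) (i : S) (s : ℝ≥0) {r : ℝ} (hr : 0 ≤ r) (ω : Ω) :
    0 ≤ occupation X i s r ω :=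
  intervalIntegral.integral_nonneg hr fun _ _ => visit_nonneg X i _ ω

theorem occupation_le (X : ℝ≥0 → Ω → S) (i : S) (s : ℝ≥0) {r : ℝ} (hr : 0 ≤ r) (ω : Ω) :
    occupation X i s r ω ≤ r := by
  have := intervalIntegral.norm_integral_le_of_norm_le_const (a := 0) (b := r)
    fun u _ => norm_visit_le_one X i (s + u.toNNReal) ω
  rw [one_mul, sub_zero, abs_of_nonneg hr] at this
  exact (le_abs_self _).trans this

theorem localTime_eq_occupation (X : ℝ≥0 → Ω → S) (i : S) (t : ℝ≥0) (ω : Ω) :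
    localTime X i t ω = occupation X i 0 t ω := by
  simp only [localTime, occupation, visit, zero_add]

theorem prod_visit_eq_indicator {ι : Type*} [Fintype ι] (X : ℝ≥0 → Ω → S) (i : S) (u : ι → ℝ≥0)
    (ω : Ω) : ∏ k, visit X i (u k) ω = Set.indicator {ω | ∀ k, X (u k) ω = i} 1 ω := by
  classical
  simp only [visit, Set.indicator_apply, Set.mem_singleton_iff, Set.mem_ofPred_eq, Pi.one_apply]
  split_ifs with h
  · exact Finset.prod_eq_one fun k _ => if_pos (h k)
  · push Not at h
    obtain ⟨k, hk⟩ := h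
    exact Finset.prod_eq_zero (Finset.mem_univ k) (if_neg hk)

theorem visit_mul_prod_visit_eq_indicator {n : ℕ} (X : ℝ≥0 → Ω → S) (i : S) (s : ℝ≥0)
    (u : Fin n → ℝ≥0) (ω : Ω) : visit X i s ω * ∏ k, visit X i (u k) ω =
      Set.indicator {ω | X s ω = i ∧ ∀ k, X (u k) ω = i} 1 ω := by
  have := prod_visit_eq_indicator X i (Fin.cons s u : Fin (n + 1) → ℝ≥0) ω
  simpa only [Fin.prod_univ_succ, Fin.forall_fin_succ, Fin.cons_zero, Fin.cons_succ] using this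

namespace IsMarkovProcess

variable [Countable S] [MeasurableSpace S] [DiscreteMeasurableSpace S] [MeasurableSpace Ω]
  {P : Measure Ω} {a : S → S → ℝ} {p : ℝ≥0 → S → S → ℝ} {i : S}
  {X : ℝ≥0 → Ω → S} (hX : IsMarkovProcess a p i P X)
include hX

theorem measurable_visit : Measurable (fun z : ℝ≥0 × Ω => visit X i z.1 z.2) :=
  (measurable_const.indicator (measurableSet_singleton i)).comp hX.measurable

theorem measurable_visit_comp {β : Type*} [MeasurableSpace β] {u : β → ℝ≥0} {v : β → Ω}
    (hu : Measurable u) (hv : Measurable v) : Measurable (fun b => visit X i (u b) (v b)) :=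
  hX.measurable_visit.comp (hu.prodMk hv)

theorem intervalIntegrable_visit (s : ℝ≥0) (ω : Ω) (x y : ℝ) :
    IntervalIntegrable (fun u : ℝ => visit X i (s + u.toNNReal) ω) volume x y :=
  (intervalIntegrable_const (c := (1 : ℝ))).mono_fun
    (hX.measurable_visit_comp (by fun_prop) measurable_const).aestronglyMeasurable
    (ae_of_all _ fun u => by simpa using norm_visit_le_one X i _ ω)

theorem measurableSet_forall_eq {n : ℕ} (u : Fin n → ℝ≥0) :
    MeasurableSet {ω | ∀ k, X (u k) ω = i} := by
  rw [Set.ofPred_forall]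
  exact MeasurableSet.iInter fun k =>
    (hX.measurable.comp (measurable_const.prodMk measurable_id)) (measurableSet_singleton i)

variable [IsProbabilityMeasure P]

theorem ae_zero_eq : ∀ᵐ ω ∂P, X 0 ω = i := by
  have h := hX.finiteDim 0 (fun _ => 0) (fun _ => i) monotone_const rfl
  simp only [Set.mem_singleton_iff, Set.indicator_of_mem,
    Finset.univ_eq_empty, Finset.prod_empty, mul_one] at h
  have hm := hX.measurableSet_forall_eq (fun _ : Fin 1 => 0)
  simp only [Fin.forall_fin_one] at hm
  exact (mem_ae_iff_prob_eq_one hm).2 (by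
    rw [← ENNReal.toReal_eq_one_iff, ← Measure.real]
    simpa only [forall_const] using h)

/-- The finite-dimensional distributions require a first time equal to 0. Prepending it changes the
event only by a null set, since X_0 = i almost surely. -/
theorem measureReal_forall_eq_of_monotone {n : ℕ} {v : Fin n → ℝ≥0} (hv : Monotone v) :
    P.real {ω | ∀ k, X (v k) ω = i} =
      ∏ k, p (v k - (Fin.cons 0 v : Fin (n + 1) → ℝ≥0) k.castSucc) i i := by
  have hmono : Monotone (Fin.cons 0 v : Fin (n + 1) → ℝ≥0) := by
    rw [Fin.monotone_iff_le_succ]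
    intro k
    cases n with
    | zero => exact k.elim0
    | succ m =>
      rw [Fin.cons_succ]
      refine Fin.cases ?_ (fun l => ?_) k
      · simp
      · rw [← Fin.succ_castSucc, Fin.cons_succ]
        exact hv (Fin.castSucc_lt_succ).le
  have h := hX.finiteDim n (Fin.cons 0 v) (fun _ => i) hmono (Fin.cons_zero _ _)
  simp only [Set.mem_singleton_iff, Set.indicator_of_mem, one_mul, Fin.cons_succ] at h
  rw [← h]
  refine measureReal_congr ?_
  filter_upwards [hX.ae_zero_eq] with ω hω
  refine propext ?_
  change (∀ k, X (v k) ω = i) ↔ ∀ k, X ((Fin.cons 0 v : Fin (n + 1) → ℝ≥0) k) ω = i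
  simp [Fin.forall_fin_succ, hω]

/-- The Markov property at time `s`, for visits at arbitrary later times. -/
theorem measureReal_eq_and_forall_eq {n : ℕ} (s : ℝ≥0) (u : Fin n → ℝ≥0) :
    P.real {ω | X s ω = i ∧ ∀ k, X (s + u k) ω = i} =
      p s i i * P.real {ω | ∀ k, X (u k) ω = i} := by
  -- The times will range over a whole cube, hence come in any order; sorting them leaves the events
  -- unchanged.
  set v := u ∘ Tuple.sort u with hv
  have hvm : Monotone v := Tuple.monotone_sort u
  have h1 : {ω | ∀ k, X (u k) ω = i} = {ω | ∀ k, X (v k) ω = i} := by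
    ext ω
    exact (Equiv.forall_congr_left (Tuple.sort u).symm).trans (by simp [hv])
  have h2 : {ω | X s ω = i ∧ ∀ k, X (s + u k) ω = i} =
      {ω | ∀ k, X ((Fin.cons s (fun k => s + v k) : Fin (n + 1) → ℝ≥0) k) ω = i} := by
    ext ω
    simp only [Set.mem_ofPred_eq, Fin.forall_fin_succ, Fin.cons_zero, Fin.cons_succ]
    exact and_congr_right fun _ =>
      (Equiv.forall_congr_left (Tuple.sort u).symm).trans (by simp [hv])
  have hcons : (Fin.cons s (fun k => s + v k) : Fin (n + 1) → ℝ≥0) =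
      fun k => s + (Fin.cons 0 v : Fin (n + 1) → ℝ≥0) k := by
    ext k
    refine Fin.cases ?_ (fun l => ?_) k <;> simp
  have hmono : Monotone (Fin.cons s (fun k => s + v k) : Fin (n + 1) → ℝ≥0) := by
    rw [Fin.monotone_iff_le_succ]
    intro k
    cases n with
    | zero => exact k.elim0
    | succ m =>
      rw [Fin.cons_succ]
      refine Fin.cases ?_ (fun l => ?_) k
      · simp
      · rw [← Fin.succ_castSucc, Fin.cons_succ]
        exact add_le_add_right (hvm (Fin.castSucc_lt_succ).le) s
  rw [h1, h2, hX.measureReal_forall_eq_of_monotone hmono, hX.measureReal_forall_eq_of_monotone hvm,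
    Fin.prod_univ_succ]
  simp only [Fin.cons_zero, Fin.castSucc_zero, tsub_zero, Fin.cons_succ, ← Fin.succ_castSucc]
  -- Shifting all times by s leaves the increments unchanged, so only the factor p_s(i,i) is new.
  rw [hcons]
  simp only [add_tsub_add_eq_tsub_left]

/-- The n-th power of an occupation time is an integral over the cube [0, r]^n of products of
visits. After Fubini, the Markov property applies for each fixed tuple of times. -/
theorem integral_visit_mul_occupation_pow (s : ℝ≥0) {r : ℝ} (hr : 0 ≤ r) (n : ℕ) :
    ∫ ω, visit X i s ω * occupation X i s r ω ^ n ∂P =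
      p s i i * ∫ ω, occupation X i 0 r ω ^ n ∂P := by
  set μ : Measure (Fin n → ℝ) := Measure.pi fun _ => volume.restrict (Set.Ioc 0 r) with hμ
  have hpow : ∀ s ω, occupation X i s r ω ^ n =
      ∫ u : Fin n → ℝ, ∏ k, visit X i (s + (u k).toNNReal) ω ∂μ := fun s ω => by
    rw [hμ, integral_fintype_prod_eq_pow (fun u : ℝ => visit X i (s + u.toNNReal) ω),
      occupation, intervalIntegral.integral_of_le hr, Fintype.card_fin]
  have hvis : ∀ (s : ℝ≥0) (k : Fin n), Measurable
      (fun z : Ω × (Fin n → ℝ) => visit X i (s + (z.2 k).toNNReal) z.1) := fun s k =>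
    hX.measurable_visit_comp (by fun_prop) measurable_fst
  have hprod : ∀ s, Measurable
      (fun z : Ω × (Fin n → ℝ) => ∏ k, visit X i (s + (z.2 k).toNNReal) z.1) := fun s =>
    Finset.measurable_fun_prod _ fun k _ => hvis s k
  have hnorm : ∀ (s : ℝ≥0) (z : Ω × (Fin n → ℝ)),
      ‖∏ k, visit X i (s + (z.2 k).toNNReal) z.1‖ ≤ 1 := fun s z => by
    rw [norm_prod]
    exact Finset.prod_le_one (fun _ _ => norm_nonneg _) fun _ _ => norm_visit_le_one _ _ _ _
  have hfub : ∫ ω, ∫ u : Fin n → ℝ, ∏ k, visit X i (0 + (u k).toNNReal) ω ∂μ ∂P =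
      ∫ u : Fin n → ℝ, ∫ ω, ∏ k, visit X i (0 + (u k).toNNReal) ω ∂P ∂μ :=
    integral_integral_swap
      (Integrable.of_bound (hprod 0).aestronglyMeasurable 1 (ae_of_all _ fun z => hnorm 0 z))
  simp_rw [hpow]
  rw [hfub]
  simp_rw [← integral_const_mul (visit X i s _)]
  rw [integral_integral_swap]
  · rw [← integral_const_mul]
    refine integral_congr_ae (ae_of_all _ fun u => ?_)
    have h1 : ∀ ω, visit X i s ω * ∏ k, visit X i (s + (u k).toNNReal) ω =
        Set.indicator {ω | X s ω = i ∧ ∀ k, X (s + (u k).toNNReal) ω = i} 1 ω :=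
      fun ω => visit_mul_prod_visit_eq_indicator X i s _ ω
    have h2 : ∀ ω, ∏ k, visit X i (0 + (u k).toNNReal) ω =
        Set.indicator {ω | ∀ k, X ((u k).toNNReal) ω = i} 1 ω := fun ω => by
      simp_rw [zero_add]
      exact prod_visit_eq_indicator X i (fun k => (u k).toNNReal) ω
    simp only [h1, h2]
    rw [integral_indicator_one, integral_indicator_one]
    · exact hX.measureReal_eq_and_forall_eq s _
    · exact hX.measurableSet_forall_eq _
    · have := hX.measurableSet_forall_eq
        (Fin.cons s (fun k => s + (u k).toNNReal) : Fin (n + 1) → ℝ≥0)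
      simpa only [Fin.forall_fin_succ, Fin.cons_zero, Fin.cons_succ] using this
  · refine Integrable.of_bound (((hX.measurable_visit_comp measurable_const measurable_fst).mul
      (hprod s)).aestronglyMeasurable) 1 (ae_of_all _ fun z => ?_)
    simp only [Function.uncurry, norm_mul]
    exact mul_le_one₀ (norm_visit_le_one _ _ _ _) (norm_nonneg _) (hnorm s z)

omit [IsProbabilityMeasure P] in
theorem measurable_occupation (s : ℝ≥0) (r : ℝ) : Measurable (occupation X i s r) := by
  have h : StronglyMeasurable (fun z : Ω × ℝ => visit X i (s + z.2.toNNReal) z.1) :=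
    (hX.measurable_visit_comp (by fun_prop) measurable_fst).stronglyMeasurable
  unfold occupation
  simp only [intervalIntegral]
  exact (h.integral_prod_right'.measurable).sub (h.integral_prod_right'.measurable)

/-- Expand the exponential into moments; the occupation time is at most r, so the series is
dominated. Only finite-dimensional distributions enter, and no conditioning on the past is required.
-/
theorem integral_visit_mul_exp_occupation (κ : ℝ) (s : ℝ≥0) {r : ℝ} (hr : 0 ≤ r) :
    ∫ ω, visit X i s ω * Real.exp (κ * occupation X i s r ω) ∂P =
      p s i i * ∫ ω, Real.exp (κ * occupation X i 0 r ω) ∂P := by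
  have key : ∀ (s : ℝ≥0) (w : Ω → ℝ), Measurable w → (∀ ω, ‖w ω‖ ≤ 1) →
      HasSum (fun n : ℕ => κ ^ n / n.factorial * ∫ ω, w ω * occupation X i s r ω ^ n ∂P)
        (∫ ω, w ω * Real.exp (κ * occupation X i s r ω) ∂P) := by
    intro s w hw hw1
    simp_rw [← integral_const_mul]
    refine hasSum_integral_of_dominated_convergence
      (fun n _ => (|κ| * r) ^ n / n.factorial) (fun n => ?_) (fun n => ae_of_all _ fun ω => ?_)
      (ae_of_all _ fun _ => Real.summable_pow_div_factorial _) (integrable_const _)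
      (ae_of_all _ fun ω => ?_)
    · exact ((hw.mul ((hX.measurable_occupation s r).pow_const n)).const_mul _).aestronglyMeasurable
    · have h0 := occupation_nonneg X i s hr ω
      have h1 := occupation_le X i s hr ω
      rw [norm_mul, norm_mul, norm_div, norm_pow, norm_pow, Real.norm_of_nonneg h0,
        Real.norm_natCast, Real.norm_eq_abs κ, mul_pow]
      calc |κ| ^ n / n.factorial * (‖w ω‖ * occupation X i s r ω ^ n)
          ≤ |κ| ^ n / n.factorial * (1 * r ^ n) := by
            gcongr
            exact hw1 ω
        _ = |κ| ^ n * r ^ n / n.factorial := by ring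
    · have := (NormedSpace.expSeries_div_hasSum_exp (κ * occupation X i s r ω)).mul_left (w ω)
      rw [← Real.exp_eq_exp_ℝ] at this
      refine this.congr_fun fun n => ?_
      rw [mul_pow]
      ring
  have h1 := key s (visit X i s) (hX.measurable_visit_comp measurable_const measurable_id)
    (fun ω => norm_visit_le_one X i s ω)
  have h2 := (key 0 (fun _ => 1) measurable_const (fun _ => by simp)).mul_left (p s i i)
  simp only [one_mul] at h2
  refine h1.unique (h2.congr_fun fun n => ?_)
  rw [hX.integral_visit_mul_occupation_pow s hr n]
  ring

end IsMarkovProcess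

end Visits

/-! ### Renewal equation and its Laplace transform -/

section LaplaceLocalTime

variable {S Ω : Type*} [MeasurableSpace Ω]

/-- The Laplace functional `E[e^{κ L_t}]` of the local time, extended to negative times. -/
noncomputable def expLocalTime (P : Measure Ω) (X : ℝ≥0 → Ω → S) (i : S) (κ t : ℝ) : ℝ :=
  ∫ ω, Real.exp (κ * localTime X i t.toNNReal ω) ∂P

theorem expLocalTime_nonneg (P : Measure Ω) (X : ℝ≥0 → Ω → S) (i : S) (κ t : ℝ) :
    0 ≤ expLocalTime P X i κ t :=
  integral_nonneg fun _ => (Real.exp_pos _).le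

omit [MeasurableSpace Ω] in
theorem localTime_nonneg (X : ℝ≥0 → Ω → S) (i : S) (t : ℝ≥0) (ω : Ω) : 0 ≤ localTime X i t ω := by
  rw [localTime_eq_occupation]
  exact occupation_nonneg X i 0 t.2 ω

namespace IsMarkovProcess

variable [Countable S] [MeasurableSpace S] [DiscreteMeasurableSpace S]
  {P : Measure Ω} {a : S → S → ℝ} {p : ℝ≥0 → S → S → ℝ} {i : S}
  {X : ℝ≥0 → Ω → S} (hX : IsMarkovProcess a p i P X)
include hX

theorem measurable_localTime (t : ℝ≥0) : Measurable (localTime X i t) := by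
  rw [funext (localTime_eq_occupation X i t)]
  exact hX.measurable_occupation 0 t

theorem intervalIntegrable_visit_toNNReal (ω : Ω) (x y : ℝ) :
    IntervalIntegrable (fun u : ℝ => visit X i u.toNNReal ω) volume x y := by
  simpa only [zero_add] using hX.intervalIntegrable_visit 0 ω x y

theorem localTime_mono {s t : ℝ≥0} (hst : s ≤ t) (ω : Ω) :
    localTime X i s ω ≤ localTime X i t ω :=
  intervalIntegral.integral_mono_interval le_rfl s.2 hst
    (ae_of_all _ fun u => visit_nonneg X i u.toNNReal ω)
    (hX.intervalIntegrable_visit_toNNReal ω 0 t)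

variable [IsProbabilityMeasure P]

theorem integrable_exp_localTime {κ : ℝ} (hκ : κ ≤ 0) (t : ℝ≥0) :
    Integrable (fun ω => Real.exp (κ * localTime X i t ω)) P :=
  Integrable.of_bound (((hX.measurable_localTime t).const_mul κ).exp).aestronglyMeasurable 1
    (ae_of_all _ fun ω => by
      rw [Real.norm_of_nonneg (Real.exp_pos _).le]
      exact Real.exp_le_one_iff.2
        (mul_nonpos_of_nonpos_of_nonneg hκ (localTime_nonneg X i t ω)))

theorem expLocalTime_antitone {κ : ℝ} (hκ : κ ≤ 0) : Antitone (expLocalTime P X i κ) :=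
  fun _ _ hst => integral_mono (hX.integrable_exp_localTime hκ _) (hX.integrable_exp_localTime hκ _)
    fun ω => Real.exp_le_exp.2
      (mul_le_mul_of_nonpos_left (hX.localTime_mono (Real.toNNReal_le_toNNReal hst) ω) hκ)

theorem expLocalTime_le_one {κ : ℝ} (hκ : κ ≤ 0) (t : ℝ) : expLocalTime P X i κ t ≤ 1 := by
  -- At times ≤ 0 the truncation `Real.toNNReal` gives local time 0; antitonicity then covers every
  -- real t.
  have h : expLocalTime P X i κ (min t 0) = 1 := by
    simp [expLocalTime, localTime, Real.toNNReal_of_nonpos (min_le_right t 0)]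
  exact (hX.expLocalTime_antitone hκ (min_le_left t 0)).trans_eq h

/-- The zeroth-moment case of the Markov property, which also yields measurability of p_s(i,i) in s.
-/
theorem transition_eq_integral (s : ℝ≥0) : p s i i = ∫ ω, visit X i s ω ∂P := by
  have := hX.integral_visit_mul_occupation_pow s le_rfl 0
  simpa using this.symm

theorem transition_le_one (s : ℝ≥0) : p s i i ≤ 1 := by
  rw [hX.transition_eq_integral]
  calc ∫ ω, visit X i s ω ∂P ≤ ∫ _, (1 : ℝ) ∂P :=
        integral_mono_of_nonneg (ae_of_all _ fun ω => visit_nonneg X i s ω) (integrable_const 1)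
          (ae_of_all _ fun ω => visit_le_one X i s ω)
    _ = 1 := by simp

theorem measurable_transition : Measurable (fun s : ℝ => p s.toNNReal i i) := by
  have h : StronglyMeasurable (fun z : ℝ × Ω => visit X i z.1.toNNReal z.2) :=
    (hX.measurable_visit_comp (by fun_prop) measurable_snd).stronglyMeasurable
  simp only [hX.transition_eq_integral]
  exact h.integral_prod_right'.measurable

/-- The renewal equation `f(t) = 1 + κ ∫_0^t p_s(i, i) f(t - s) ds` for `f(t) = E[e^{κ L_t}]`. -/
theorem expLocalTime_renewal {κ : ℝ} (hκ : κ ≤ 0) {t : ℝ} (ht : 0 ≤ t) :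
    expLocalTime P X i κ t =
      1 + κ * ∫ s in (0 : ℝ)..t, p s.toNNReal i i * expLocalTime P X i κ (t - s) := by
  have hvis : Measurable (fun z : Ω × ℝ => visit X i z.2.toNNReal z.1) :=
    hX.measurable_visit_comp (by fun_prop) measurable_fst
  have hpath : ∀ ω, Real.exp (κ * localTime X i t.toNNReal ω) = 1 + κ * ∫ s in (0 : ℝ)..t,
      visit X i s.toNNReal ω * Real.exp (κ * ∫ u in s..t, visit X i u.toNNReal ω) := fun ω => by
    rw [localTime, Real.coe_toNNReal t ht]
    exact exp_mul_integral_sub_one (hX.measurable_visit_comp (by fun_prop) measurable_const)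
      (fun s => visit_nonneg X i _ ω) (fun s => visit_le_one X i _ ω) hκ ht
  -- Joint measurability: the integral is continuous in its lower limit s and measurable in ω.
  have hmeas : Measurable (fun z : Ω × ℝ => ∫ u in z.2..t, visit X i u.toNNReal z.1) := by
    have h1 : StronglyMeasurable (Function.uncurry fun (s : ℝ) (ω : Ω) =>
        ∫ u in s..t, visit X i u.toNNReal ω) := by
      refine stronglyMeasurable_uncurry_of_continuous_of_stronglyMeasurable (fun ω => ?_)
        fun s => ?_
      · have := intervalIntegral.continuous_primitive
          (hX.intervalIntegrable_visit_toNNReal ω) t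
        exact this.neg.congr fun s => (intervalIntegral.integral_symm _ _).symm
      · simp only [intervalIntegral]
        exact (hvis.stronglyMeasurable.integral_prod_right').sub
          hvis.stronglyMeasurable.integral_prod_right'
    exact h1.measurable.comp measurable_swap
  have hexp1 : ∀ ω, ∀ s ∈ Set.Ioc 0 t,
      Real.exp (κ * ∫ u in s..t, visit X i u.toNNReal ω) ≤ 1 := fun ω s hs =>
    Real.exp_le_one_iff.2 (mul_nonpos_of_nonpos_of_nonneg hκ
      (intervalIntegral.integral_nonneg hs.2 fun u _ => visit_nonneg X i _ ω))
  have hint : Integrable (Function.uncurry fun (ω : Ω) (s : ℝ) => visit X i s.toNNReal ω *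
      Real.exp (κ * ∫ u in s..t, visit X i u.toNNReal ω))
      (P.prod (volume.restrict (Set.Ioc 0 t))) := by
    refine Integrable.of_bound (hvis.mul (hmeas.const_mul κ).exp).aestronglyMeasurable 1 ?_
    have : ∀ᵐ z ∂(P.prod (volume.restrict (Set.Ioc 0 t))), z.2 ∈ Set.Ioc 0 t :=
      Measure.quasiMeasurePreserving_snd.ae (ae_restrict_mem measurableSet_Ioc)
    filter_upwards [this] with z hz
    simp only [Function.uncurry, norm_mul, Real.norm_of_nonneg (Real.exp_pos _).le]
    exact mul_le_one₀ (norm_visit_le_one X i _ _) (Real.exp_pos _).le (hexp1 _ _ hz)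
  have hswap := integral_integral_swap hint
  simp_rw [expLocalTime, hpath, intervalIntegral.integral_of_le ht]
  have hint' := hint.integral_prod_left.const_mul κ
  simp only [Function.uncurry] at hint'
  rw [integral_add (integrable_const 1) hint', integral_const_mul, hswap]
  simp only [integral_const, probReal_univ, smul_eq_mul, mul_one]
  congr 2
  refine setIntegral_congr_fun measurableSet_Ioc fun s hs => ?_
  have hts : 0 ≤ t - s := sub_nonneg.2 hs.2
  have hocc : ∀ ω, ∫ u in s..t, visit X i u.toNNReal ω =
      occupation X i s.toNNReal (t - s) ω := fun ω => by
    have h := intervalIntegral.integral_comp_add_left (a := 0) (b := t - s)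
      (fun u => visit X i u.toNNReal ω) s
    rw [add_zero, add_sub_cancel] at h
    rw [← h, occupation]
    refine intervalIntegral.integral_congr fun u hu => ?_
    rw [Set.uIcc_of_le hts] at hu
    simp only [Real.toNNReal_add hs.1.le hu.1]
  simp only [hocc]
  rw [hX.integral_visit_mul_exp_occupation κ _ hts]
  simp only [localTime_eq_occupation, Real.coe_toNNReal _ hts]

theorem integrableOn_exp_neg_mul_expLocalTime {κ : ℝ} (hκ : κ ≤ 0) {l : ℝ} (hl : 0 < l) :
    IntegrableOn (fun t : ℝ => Real.exp (-(l * t)) * expLocalTime P X i κ t) (Set.Ioi 0) :=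
  integrableOn_exp_neg_mul_of_bounded (hX.expLocalTime_antitone hκ).measurable
    (expLocalTime_nonneg P X i κ) (hX.expLocalTime_le_one hκ) hl

theorem laplaceTransform_expLocalTime {κ : ℝ} (hκ : κ ≤ 0) {l : ℝ} (hl : 0 < l) :
    laplaceTransform (expLocalTime P X i κ) l =
      1 / (l * (1 - κ * laplaceTransform (fun t => p t.toNNReal i i) l)) := by
  set F := laplaceTransform (expLocalTime P X i κ) l with hF
  set G := laplaceTransform (fun t => p t.toNNReal i i) l with hG
  have hp := integrableOn_exp_neg_mul_of_bounded hX.measurable_transition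
    (fun _ => hX.isTransitionFunction.nonneg _ _ _) (fun _ => hX.transition_le_one _) hl
  have hf := hX.integrableOn_exp_neg_mul_expLocalTime hκ hl
  -- Since e^{-lt} = e^{-ls} e^{-l(t-s)}, the weight distributes over the convolution, and the
  -- integral of the convolution is the product G F.
  have hconv := integral_posConvolution hp hf (ContinuousLinearMap.mul ℝ ℝ)
  have hconvi := integrable_posConvolution hp hf (ContinuousLinearMap.mul ℝ ℝ)
  have hG0 : 0 ≤ G := setIntegral_nonneg measurableSet_Ioi fun t _ =>
    mul_nonneg (Real.exp_pos _).le (hX.isTransitionFunction.nonneg _ _ _)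
  have hone : ∫ t in Set.Ioi (0 : ℝ), Real.exp (-(l * t)) = 1 / l := by
    have := Real.integral_rpow_mul_exp_neg_mul_Ioi one_pos hl
    simpa using this
  have heq : ∀ t ∈ Set.Ioi (0 : ℝ), Real.exp (-(l * t)) * expLocalTime P X i κ t =
      Real.exp (-(l * t)) + κ * ∫ s in (0 : ℝ)..t, ContinuousLinearMap.mul ℝ ℝ
        (Real.exp (-(l * s)) * p s.toNNReal i i)
        (Real.exp (-(l * (t - s))) * expLocalTime P X i κ (t - s)) := fun t ht => by
    rw [hX.expLocalTime_renewal hκ (le_of_lt ht), mul_add, mul_one, mul_left_comm,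
      ← intervalIntegral.integral_const_mul]
    congr 3 with s
    rw [ContinuousLinearMap.mul_apply', show -(l * t) = -(l * s) + -(l * (t - s)) by ring,
      Real.exp_add]
    ring
  have hint : IntegrableOn (fun t => ∫ s in (0 : ℝ)..t, ContinuousLinearMap.mul ℝ ℝ
        (Real.exp (-(l * s)) * p s.toNNReal i i)
        (Real.exp (-(l * (t - s))) * expLocalTime P X i κ (t - s))) (Set.Ioi 0) := by
    rw [posConvolution, integrable_indicator_iff measurableSet_Ioi] at hconvi
    exact hconvi
  have key : F = 1 / l + κ * (G * F) := by
    conv_lhs => rw [hF, laplaceTransform]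
    rw [setIntegral_congr_fun measurableSet_Ioi heq,
      integral_add (integrableOn_exp_neg_mul hl) (hint.const_mul κ), integral_const_mul, hconv, hone]
    rfl
  have hpos : 0 < 1 - κ * G := by nlinarith
  field_simp at key ⊢
  linarith

end IsMarkovProcess

end LaplaceLocalTime

/-! ### From the transform to large times -/

namespace IsMarkovProcess

variable {S Ω : Type*} [MeasurableSpace Ω] [Countable S] [MeasurableSpace S]
  [DiscreteMeasurableSpace S] {P : Measure Ω} [IsProbabilityMeasure P] {a : S → S → ℝ}
  {p : ℝ≥0 → S → S → ℝ} {i : S} {X : ℝ≥0 → Ω → S} (hX : IsMarkovProcess a p i P X)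
include hX

/-- Karamata's theorem with N(l) = l / M(l): the quantity N(l) f̂(ml) equals 1 / (m M(l) (1 - κ
q̂(ml))), which tends to D⁻¹ m^{-β}. The exponent β - 1 in the hypothesis encodes the regular
variation of 1 - κ q̂. -/
theorem tendsto_expLocalTime_div {κ β D : ℝ} (hκ : κ ≤ 0) (hβ : 0 < β) (hβ1 : β ≤ 1) (hD : 0 < D)
    {M : ℝ → ℝ} (hM : ∀ᶠ l in 𝓝[>] (0 : ℝ), 0 < M l)
    (h : ∀ m : ℝ, 0 < m → Tendsto
      (fun l => M l * (1 - κ * laplaceTransform (fun t => p t.toNNReal i i) (m * l)))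
      (𝓝[>] 0) (𝓝 (D * m ^ (β - 1)))) :
    Tendsto (fun t => expLocalTime P X i κ t / M t⁻¹) atTop (𝓝 (1 / (D * Real.Gamma β))) := by
  have key := tendsto_of_tendsto_mul_laplaceTransform (f := expLocalTime P X i κ)
    (N := fun l => l / M l) (C := 1 / D) (α := β)
    (fun l hl => hX.integrableOn_exp_neg_mul_expLocalTime hκ hl)
    (expLocalTime_nonneg P X i κ) (hX.expLocalTime_antitone hκ)
    (by filter_upwards [hM, self_mem_nhdsWithin] with l h1 (h2 : 0 < l); positivity)
    hβ hβ1 (by positivity) fun n => ?_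
  · rw [div_div] at key
    refine (key.comp tendsto_inv_atTop_nhdsGT_zero).congr' ?_
    filter_upwards [eventually_gt_atTop 0] with t ht
    simp only [Function.comp_apply, inv_inv]
    field_simp
  · have hm : (0 : ℝ) < (n : ℝ) + 1 := by positivity
    have h1 := ((h _ hm).inv₀ (by positivity)).const_mul ((n : ℝ) + 1)⁻¹
    have h2 : ((n : ℝ) + 1)⁻¹ * (D * ((n : ℝ) + 1) ^ (β - 1))⁻¹ =
        1 / D * ((n : ℝ) + 1) ^ (-β) := by
      rw [Real.rpow_sub_one hm.ne', Real.rpow_neg hm.le]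
      field_simp
    rw [h2] at h1
    refine h1.congr' ?_
    filter_upwards [hM, self_mem_nhdsWithin] with l hMl (hl : 0 < l)
    rw [hX.laplaceTransform_expLocalTime hκ (mul_pos hm hl), mul_inv]
    field_simp

end IsMarkovProcess

theorem isEquivalent_of_tendsto_expLocalTime_div {S Ω : Type*} [MeasurableSpace Ω] {P : Measure Ω}
    {X : ℝ≥0 → Ω → S} {i : S} {κ K : ℝ} {M : ℝ → ℝ} {v : ℝ≥0 → ℝ} (hK : K ≠ 0)
    (hv : ∀ᶠ t : ℝ≥0 in atTop, v t ≠ 0 ∧ M (t : ℝ)⁻¹ * K = v t)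
    (h : Tendsto (fun t => expLocalTime P X i κ t / M t⁻¹) atTop (𝓝 K)) :
    (fun t : ℝ≥0 => ∫ ω, Real.exp (κ * localTime X i t ω) ∂P) ~[atTop] v := by
  rw [isEquivalent_iff_tendsto_one (hv.mono fun t ht => ht.1)]
  have h1 := (h.comp (NNReal.tendsto_coe_atTop.2 tendsto_id)).div_const K
  rw [div_self hK] at h1
  refine h1.congr' ?_
  filter_upwards [hv] with t ht
  simp only [Function.comp_apply, id, Pi.div_apply, expLocalTime, Real.toNNReal_coe]
  rw [div_div, ht.2]

theorem mainTheorem10 {S Ω : Type*} [Countable S] [MeasurableSpace S] [DiscreteMeasurableSpace S]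
    [MeasurableSpace Ω] (P : Measure Ω) [IsProbabilityMeasure P]
    (a : S → S → ℝ) (p : ℝ≥0 → S → S → ℝ) (i : S) (X : ℝ≥0 → Ω → S)
    (hX : IsMarkovProcess a p i P X)
    (c α κ : ℝ) (hc : 0 < c) (hα : 0 < α) (hκ : κ < 0)
    (hp : (fun t : ℝ≥0 => p t i i) ~[atTop] (fun t : ℝ≥0 => c * (t : ℝ) ^ (-α))) :
    (∀ t : ℝ≥0, Integrable (fun ω => Real.exp (κ * localTime X i t ω)) P) ∧
    (α < 1 →
      (fun t : ℝ≥0 => ∫ ω, Real.exp (κ * localTime X i t ω) ∂P) ~[atTop]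
        (fun t : ℝ≥0 => 1 / (t : ℝ) ^ (1 - α) *
          (1 / (-κ * c * Real.Gamma (1 - α) * Real.Gamma α)))) ∧
    (α = 1 →
      (fun t : ℝ≥0 => ∫ ω, Real.exp (κ * localTime X i t ω) ∂P) ~[atTop]
        (fun t : ℝ≥0 => 1 / Real.log (t : ℝ) * (1 / (-κ * c)))) ∧
    (1 < α →
      greenFunction p i i ≠ ∞ ∧
      (fun t : ℝ≥0 => ∫ ω, Real.exp (κ * localTime X i t ω) ∂P) ~[atTop]
        (fun _ : ℝ≥0 => 1 / (1 - κ * (greenFunction p i i).toReal))) := by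
  set q : ℝ → ℝ := fun t => p t.toNNReal i i with hq
  have hqm : Measurable q := hX.measurable_transition
  have hq0 : ∀ t, 0 ≤ q t := fun t => hX.isTransitionFunction.nonneg _ _ _
  have hq1 : ∀ t, q t ≤ 1 := fun t => hX.transition_le_one _
  have hκ' : 0 < -κ := neg_pos.2 hκ
  have hlim : Tendsto (fun t => t ^ α * q t) atTop (𝓝 c) := by
    rw [isEquivalent_iff_tendsto_one] at hp
    · have h1 := (hp.comp tendsto_real_toNNReal_atTop).const_mul c
      rw [mul_one] at h1
      refine h1.congr' ?_
      filter_upwards [eventually_gt_atTop 0] with t ht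
      simp only [Function.comp_apply, Pi.div_apply, Real.coe_toNNReal t ht.le, hq]
      rw [Real.rpow_neg ht.le]
      have := (Real.rpow_pos_of_pos ht α).ne'
      field_simp
    · filter_upwards [eventually_gt_atTop 0] with t ht
      have : (0 : ℝ) < t := ht
      positivity
  have hscale : ∀ m : ℝ, 0 < m → Tendsto (fun l => m * l) (𝓝[>] 0) (𝓝[>] 0) := fun m hm => by
    refine tendsto_nhdsWithin_iff.2 ⟨?_, ?_⟩
    · have : Tendsto (fun l : ℝ => m * l) (𝓝 0) (𝓝 (m * 0)) := (continuous_const_mul m).tendsto 0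
      rw [mul_zero] at this
      exact this.mono_left nhdsWithin_le_nhds
    · filter_upwards [self_mem_nhdsWithin] with l hl using mul_pos hm hl
  refine ⟨hX.integrable_exp_localTime hκ.le, fun hα1 => ?_, fun hα1 => ?_, fun hα1 => ?_⟩
  -- Here M(l) = l^{1-α} and β = α. The summand 1 in 1 - κ q̂ is negligible, as q̂ diverges.
  · have hΓ1 := Real.Gamma_pos_of_pos (sub_pos.2 hα1)
    have hΓ := Real.Gamma_pos_of_pos hα
    have hD : 0 < -κ * c * Real.Gamma (1 - α) := by positivity
    have hlap := tendsto_rpow_mul_laplaceTransform hqm hq0 hq1 hα hα1 hlim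
    have hpow : Tendsto (fun l : ℝ => l ^ (1 - α)) (𝓝[>] 0) (𝓝 0) := by
      have := (Real.continuousAt_rpow_const 0 (1 - α) (Or.inr (sub_pos.2 hα1).le)).tendsto
      rw [Real.zero_rpow (sub_pos.2 hα1).ne'] at this
      exact this.mono_left nhdsWithin_le_nhds
    have h1 : Tendsto (fun l => l ^ (1 - α) * (1 - κ * laplaceTransform q l)) (𝓝[>] 0)
        (𝓝 (-κ * c * Real.Gamma (1 - α))) := by
      have := hpow.sub (hlap.const_mul κ)
      rw [show 0 - κ * (c * Real.Gamma (1 - α)) = -κ * c * Real.Gamma (1 - α) by ring] at this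
      exact this.congr fun l => by ring
    refine isEquivalent_of_tendsto_expLocalTime_div (M := fun l => l ^ (1 - α))
      (one_div_pos.2 (mul_pos hD hΓ)).ne' ?_
      (hX.tendsto_expLocalTime_div (M := fun l => l ^ (1 - α)) hκ.le hα hα1.le hD ?_ fun m hm => ?_)
    · filter_upwards [eventually_gt_atTop 0] with t ht
      have ht' : (0 : ℝ) < t := ht
      refine ⟨by positivity, ?_⟩
      rw [Real.inv_rpow ht'.le, one_div ((t : ℝ) ^ (1 - α))]
    · filter_upwards [self_mem_nhdsWithin] with l (hl : 0 < l)
      positivity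
    · have h2 := (h1.comp (hscale m hm)).mul_const (m ^ (α - 1))
      refine h2.congr' ?_
      filter_upwards [self_mem_nhdsWithin] with l (hl : 0 < l)
      have h3 : m ^ (1 - α) * m ^ (α - 1) = 1 := by
        rw [← Real.rpow_add hm]; simp
      simp only [Function.comp_apply]
      rw [Real.mul_rpow hm.le hl.le]
      linear_combination (l ^ (1 - α) * (1 - κ * laplaceTransform q (m * l))) * h3
  -- Here M(l) = 1 / log(1/l) and β = 1; the summand 1 is again negligible.
  · subst hα1
    have hD : 0 < -κ * c := by positivity
    have hlap := tendsto_inv_log_mul_laplaceTransform hqm hq0 hq1 (by simpa using hlim)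
    have hinv := tendsto_inv_atTop_zero.comp tendsto_log_inv_nhdsGT_zero
    have h1 : Tendsto (fun l => (Real.log l⁻¹)⁻¹ * (1 - κ * laplaceTransform q l)) (𝓝[>] 0)
        (𝓝 (-κ * c)) := by
      have := hinv.sub (hlap.const_mul κ)
      rw [show 0 - κ * c = -κ * c by ring] at this
      refine this.congr fun l => ?_
      simp only [Function.comp_apply]
      ring
    have h4 := hX.tendsto_expLocalTime_div (M := fun l => (Real.log l⁻¹)⁻¹) hκ.le one_pos le_rfl
      hD ?_ fun m hm => ?_
    · rw [Real.Gamma_one, mul_one] at h4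
      refine isEquivalent_of_tendsto_expLocalTime_div (M := fun l => (Real.log l⁻¹)⁻¹)
        (one_div_pos.2 hD).ne' ?_ h4
      filter_upwards [eventually_gt_atTop 1] with t ht
      have ht' : (1 : ℝ) < t := ht
      have := Real.log_pos ht'
      refine ⟨by positivity, ?_⟩
      rw [inv_inv, one_div (Real.log t)]
    · filter_upwards [tendsto_log_inv_nhdsGT_zero.eventually_gt_atTop 0] with l hl
      positivity
    -- Slow variation of the logarithm: log(1/(ml)) = log(1/l) - log m.
    · have h2 : Tendsto (fun l : ℝ => Real.log (m * l)⁻¹ * (Real.log l⁻¹)⁻¹) (𝓝[>] 0) (𝓝 1) := by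
        have := (hinv.const_mul (-Real.log m)).const_add 1
        rw [mul_zero, add_zero] at this
        refine this.congr' ?_
        filter_upwards [self_mem_nhdsWithin,
          tendsto_log_inv_nhdsGT_zero.eventually_gt_atTop 0] with l (hl : 0 < l) hlog
        rw [Real.log_inv, Real.log_mul hm.ne' hl.ne']
        rw [Real.log_inv] at hlog
        have := (neg_pos.1 hlog).ne
        simp only [Function.comp_apply, Real.log_inv]
        field_simp
        ring
      have h3 := (h1.comp (hscale m hm)).mul h2
      rw [mul_one] at h3
      rw [sub_self, Real.rpow_zero, mul_one]
      refine h3.congr' ?_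
      filter_upwards [(tendsto_log_inv_nhdsGT_zero.comp (hscale m hm)).eventually_gt_atTop 0]
        with l hl
      simp only [Function.comp_apply] at hl ⊢
      change _ = (Real.log l⁻¹)⁻¹ * (1 - κ * laplaceTransform q (m * l))
      linear_combination ((Real.log l⁻¹)⁻¹ * (1 - κ * laplaceTransform q (m * l))) *
        inv_mul_cancel₀ hl.ne'
  -- Here q is integrable, so q̂(0+) = G_∞ is finite. With M = 1 and β = 1, the summand 1 survives
  -- in the limit.
  · have hqi := integrableOn_Ioi_of_tendsto_rpow_mul hqm hq0 hq1 hα1 hlim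
    have hgreen : greenFunction p i i = ENNReal.ofReal (∫ t in Set.Ioi (0 : ℝ), q t) :=
      (ofReal_integral_eq_lintegral_ofReal hqi (ae_of_all _ hq0)).symm
    have hG0 : 0 ≤ ∫ t in Set.Ioi (0 : ℝ), q t := integral_nonneg hq0
    rw [hgreen, ENNReal.toReal_ofReal hG0]
    refine ⟨ENNReal.ofReal_ne_top, ?_⟩
    set G := ∫ t in Set.Ioi (0 : ℝ), q t
    have hD : 0 < 1 - κ * G := by nlinarith
    have hlap := tendsto_laplaceTransform_of_integrableOn hqi
    have h4 := hX.tendsto_expLocalTime_div (M := fun _ => 1) hκ.le one_pos le_rfl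
      hD (Eventually.of_forall fun _ => one_pos) fun m hm => ?_
    · rw [Real.Gamma_one, mul_one] at h4
      exact isEquivalent_of_tendsto_expLocalTime_div (M := fun _ => 1) (one_div_pos.2 hD).ne'
        (Eventually.of_forall fun t => ⟨(one_div_pos.2 hD).ne', one_mul _⟩) h4
    · rw [sub_self, Real.rpow_zero, mul_one]
      simp only [one_mul]
      exact ((hlap.comp (hscale m hm)).const_mul κ).const_sub 1
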